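/- **Setting.** S-expressions are words, unsigned integers, and finite (possibly empty) lists of S-expressions; words are non-empty strings of printable non-blank ASCII characters other than parentheses that are not decimal numerals. Consider Chaitin's LISP: every word evaluates to itself, except `nil`, which evaluates to the empty list `()`; numbers and `()` evaluate to themselves; the primitives are `'` (quote), `if`, `car`, `cdr`, `cons`, `atom`, `=`, `append`, `length`, `size`, `bits`, `+ - * ^ < > <= >=`, `base2-to-10`, `base10-to-2`, `debug`, `display`, `eval` (which evaluates the value of its argument in the initial environment), `read-bit`, `read-exp` and `try`; all other functions are `(lambda (variables) body)` with dynamic scoping. An evaluation may be supplied with a finite string of raw binary data: `(read-bit)` reads the next bit, `(read-exp)` reads 8-bit ASCII characters up to and including the next newline and returns the S-expression written on that line; reading past the end of the data aborts the evaluation (*out-of-data*). `(try t e b)` evaluates $e$ in the initial environment with time limit $t$ (a bound on the nesting depth of calls, or `no-time-limit`) and with the list of bits $b$ as its binary data, and returns `(success value displays)` or `(failure out-of-time displays)` or `(failure out-of-data displays)`, where *displays* is the list of the arguments of `display` in the course of the evaluation. For an S-expression $e$ let $\mathrm{bits}(e)$ be the bit string that consists of the canonical text of $e$ (fully parenthesized,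 exactly one blank between successive elements of a list) followed by a newline character, eight bits per character. The self-delimiting universal computer $U$ is the following partial function from bit strings to S-expressions: $U(p)$ is the value of `(eval (read-exp))`, evaluated without time limit in the initial environment with binary data $p$, provided that this evaluation terminates, does not run out of data, and reads all of $p$; otherwise $U(p)$ is undefined. As a LISP function, $U$ is `(car (cdr (try no-time-limit (' (eval (read-exp))) p)))`. Put $$H(x)=\min_{U(p)=x}|p|,\qquad H(x,y)=H(\langle x,y\rangle),\qquad \langle x,y\rangle=(x\;y),$$ where $(x\;y)$ is the list with the two elements $x,y$, and call $p$ an elegant program for $x$ if $U(p)=x$ and $|p|=H(x)$. **Theorem.** Let $$\pi=\mathrm{bits}\bigl(\texttt{(cons (eval (read-exp)) (cons (eval (read-exp)) nil))}\bigr).$$ 1. $|\pi|=432$. 2. For all S-expressions $x,y$ and all elegant programs $x^*$ for $x$ and $y^*$ for $y$, $$U(\pi\,x^*\,y^*)=(x\;y)=\langle x,y\rangle ,$$ and the LISP function `(car (cdr (try no-time-limit (' (eval (read-exp))) p)))` takes the same value $(x\;y)$ at $p=\pi\,x^*\,y^*$. 3. Consequently, for all S-expressions $x,y$, $$H(x,y)\le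 H(x)+H(y)+432 .$$ -/

import Mathlib

namespace ChaitinLisp

/-! ### Characters, given by their ASCII codes -/

namespace Ascii

abbrev newline : ℕ := 10
abbrev blank : ℕ := 32
abbrev quoteMark : ℕ := 39
abbrev lparen : ℕ := 40
abbrev rparen : ℕ := 41
abbrev star : ℕ := 42
abbrev plus : ℕ := 43
abbrev hyphen : ℕ := 45
abbrev digit (n : ℕ) : ℕ := 48 + n
abbrev less : ℕ := 60
abbrev equals : ℕ := 61
abbrev greater : ℕ := 62
abbrev caret : ℕ := 94
abbrev a : ℕ := 97
abbrev b : ℕ := 98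
abbrev c : ℕ := 99
abbrev d : ℕ := 100
abbrev e : ℕ := 101
abbrev f : ℕ := 102
abbrev g : ℕ := 103
abbrev h : ℕ := 104
abbrev i : ℕ := 105
abbrev l : ℕ := 108
abbrev m : ℕ := 109
abbrev n : ℕ := 110
abbrev o : ℕ := 111
abbrev p : ℕ := 112
abbrev q : ℕ := 113
abbrev r : ℕ := 114
abbrev s : ℕ := 115
abbrev t : ℕ := 116
abbrev u : ℕ := 117
abbrev v : ℕ := 118
abbrev x : ℕ := 120
abbrev y : ℕ := 121
abbrev z : ℕ := 122

/-- A decimal digit. -/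
abbrev IsDigit (k : ℕ) : Prop := digit 0 ≤ k ∧ k ≤ digit 9

/-- A printable non-blank character other than a parenthesis. -/
abbrev IsWordChar (k : ℕ) : Prop := 33 ≤ k ∧ k ≤ 126 ∧ k ≠ lparen ∧ k ≠ rparen

end Ascii

/-! ### S-expressions -/

/-- A symbolic atom: a non-empty string of word characters that is not a decimal numeral. -/
abbrev Word : Type :=
  {w : List ℕ // w ≠ [] ∧ (∀ k ∈ w, Ascii.IsWordChar k) ∧ ¬ ∀ k ∈ w, Ascii.IsDigit k}

/-- S-expressions: words, unsigned integers and (possibly empty) lists.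
The empty list `()` counts as an atom. -/
inductive Sexp : Type
  | word : Word → Sexp
  | num : ℕ → Sexp
  | list : List Sexp → Sexp

mutual

def Sexp.decEq : (s s' : Sexp) → Decidable (s = s')
  | .word w, .word w' => decidable_of_iff (w = w') (by simp)
  | .num k, .num k' => decidable_of_iff (k = k') (by simp)
  | .list l, .list l' =>
    match Sexp.decEqList l l' with
    | isTrue h => isTrue (by rw [h])
    | isFalse h => isFalse (by simpa using h)
  | .word _, .num _ => isFalse (by simp)
  | .word _, .list _ => isFalse (by simp)
  | .num _, .word _ => isFalse (by simp)
  | .num _, .list _ => isFalse (by simp)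
  | .list _, .word _ => isFalse (by simp)
  | .list _, .num _ => isFalse (by simp)

def Sexp.decEqList : (l l' : List Sexp) → Decidable (l = l')
  | [], [] => isTrue rfl
  | [], _ :: _ => isFalse (by simp)
  | _ :: _, [] => isFalse (by simp)
  | s :: l, s' :: l' =>
    match Sexp.decEq s s', Sexp.decEqList l l' with
    | isTrue h, isTrue h' => isTrue (by rw [h, h'])
    | isFalse h, _ => isFalse (fun e => h (List.cons.inj e).1)
    | _, isFalse h => isFalse (fun e => h (List.cons.inj e).2)

end

instance : DecidableEq Sexp := Sexp.decEq

/-! ### The words that have a predefined meaning -/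

namespace Kw

section
open Ascii

def nil : Word := ⟨[n, i, l], by decide⟩
def true : Word := ⟨[t, r, u, e], by decide⟩
def false : Word := ⟨[f, a, l, s, e], by decide⟩
def success : Word := ⟨[s, u, c, c, e, s, s], by decide⟩
def failure : Word := ⟨[f, a, i, l, u, r, e], by decide⟩
def noTimeLimit : Word :=
  ⟨[n, o, hyphen, t, i, m, e, hyphen, l, i, m, i, t], by decide⟩
def outOfTime : Word := ⟨[o, u, t, hyphen, o, f, hyphen, t, i, m, e], by decide⟩
def outOfData : Word := ⟨[o, u, t, hyphen, o, f, hyphen, d, a, t, a], by decide⟩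
def quote : Word := ⟨[quoteMark], by decide⟩
def cond : Word := ⟨[i, f], by decide⟩
def display : Word := ⟨[d, i, s, p, l, a, y], by decide⟩
def readBit : Word := ⟨[r, e, a, d, hyphen, b, i, t], by decide⟩
def readExp : Word := ⟨[r, e, a, d, hyphen, e, x, p], by decide⟩
def eval : Word := ⟨[e, v, a, l], by decide⟩
def attempt : Word := ⟨[t, r, y], by decide⟩
def car : Word := ⟨[c, a, r], by decide⟩
def cdr : Word := ⟨[c, d, r], by decide⟩
def cons : Word := ⟨[c, o, n, s], by decide⟩
def atom : Word := ⟨[a, t, o, m], by decide⟩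
def eq : Word := ⟨[equals], by decide⟩
def append : Word := ⟨[a, p, p, e, n, d], by decide⟩
def length : Word := ⟨[l, e, n, g, t, h], by decide⟩
def size : Word := ⟨[s, i, z, e], by decide⟩
def bits : Word := ⟨[b, i, t, s], by decide⟩
def debug : Word := ⟨[d, e, b, u, g], by decide⟩
def add : Word := ⟨[plus], by decide⟩
def sub : Word := ⟨[hyphen], by decide⟩
def mul : Word := ⟨[star], by decide⟩
def pow : Word := ⟨[caret], by decide⟩
def lt : Word := ⟨[less], by decide⟩
def gt : Word := ⟨[greater], by decide⟩
def le : Word := ⟨[less, equals], by decide⟩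
def ge : Word := ⟨[greater, equals], by decide⟩
def base2to10 : Word :=
  ⟨[b, a, s, e, digit 2, hyphen, t, o, hyphen, digit 1, digit 0], by decide⟩
def base10to2 : Word :=
  ⟨[b, a, s, e, digit 1, digit 0, hyphen, t, o, hyphen, digit 2], by decide⟩

end

end Kw

/-! ### Printing S-expressions and converting them to bits -/

/-- The decimal numeral of `k`, without leading zeros. -/
def numeral (k : ℕ) : List ℕ :=
  if k = 0 then [Ascii.digit 0] else (Nat.digits 10 k).reverse.map Ascii.digit

mutual

/-- The canonical text of an S-expression: exactly one blank between successive elements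
of a list. -/
def Sexp.text : Sexp → List ℕ
  | .word w => w.1
  | .num k => numeral k
  | .list l => [Ascii.lparen] ++ Sexp.textElems l ++ [Ascii.rparen]

def Sexp.textElems : List Sexp → List ℕ
  | [] => []
  | [s] => Sexp.text s
  | s :: s' :: l => Sexp.text s ++ [Ascii.blank] ++ Sexp.textElems (s' :: l)

end

/-- The eight bits of a character, most significant bit first. -/
def charBits (k : ℕ) : List Bool :=
  [k.testBit 7, k.testBit 6, k.testBit 5, k.testBit 4,
   k.testBit 3, k.testBit 2, k.testBit 1, k.testBit 0]

/-- The bit string of an S-expression: its text followed by a newline, eight bits per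
character. -/
def Sexp.toBits (s : Sexp) : List Bool :=
  (s.text ++ [Ascii.newline]).flatMap charBits

/-! ### Reading S-expressions from a bit string -/

inductive Token : Type
  | lparen : Token
  | rparen : Token
  | atom : Sexp → Token

/-- The atom spelled by a string of characters; a string of digits is a number. -/
def atomOf (w : List ℕ) : Option Sexp :=
  if hw : w ≠ [] ∧ (∀ k ∈ w, Ascii.IsWordChar k) ∧ ¬ ∀ k ∈ w, Ascii.IsDigit k then
    some (.word ⟨w, hw⟩)
  else if w ≠ [] ∧ ∀ k ∈ w, Ascii.IsDigit k then
    some (.num (w.foldl (fun m k => 10 * m + (k - Ascii.digit 0)) 0))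
  else none

/-- Emit the atom (if any) spelled by the characters collected so far. -/
def flush (cur : List ℕ) (ts : List Token) : List Token :=
  match atomOf cur with
  | some s => .atom s :: ts
  | none => ts

/-- Split a line into tokens; `cur` is the part of the current atom that has been read.
Unprintable characters are skipped. -/
def tokens : List ℕ → List ℕ → List Token
  | [], cur => flush cur []
  | k :: ks, cur =>
    if k = Ascii.lparen then flush cur (.lparen :: tokens ks [])
    else if k = Ascii.rparen then flush cur (.rparen :: tokens ks [])
    else if k = Ascii.blank then flush cur (tokens ks [])
    else if Ascii.IsWordChar k then tokens ks (cur ++ [k])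
    else tokens ks cur

/-- Close all the lists that are still open. -/
def closeAll : Sexp → List (List Sexp) → Sexp
  | s, [] => s
  | s, l :: rest => closeAll (.list (l ++ [s])) rest

/-- Read the first S-expression of a list of tokens; the second argument holds the lists
that are currently open, innermost first. Missing right parentheses are supplied at the
end, anything after the first complete S-expression is ignored, and an empty line or a
line that starts with a right parenthesis reads as `()`. -/
def parse : List Token → List (List Sexp) → Sexp
  | [], [] => .list []
  | [], l :: rest => closeAll (.list l) rest
  | .atom s :: _, [] => s
  | .atom s :: ts, l :: rest => parse ts ((l ++ [s]) :: rest)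
  | .lparen :: ts, opened => parse ts ([] :: opened)
  | .rparen :: _, [] => .list []
  | .rparen :: _, [l] => .list l
  | .rparen :: ts, l :: l' :: rest => parse ts ((l' ++ [.list l]) :: rest)

/-- The S-expression on a line of text. -/
def parseLine (line : List ℕ) : Sexp := parse (tokens line []) []

/-- Read characters of eight bits up to and including the first newline. The result is the
line, without the newline, and the unread bits; it is `none` if the data runs out first. -/
def readLine : List Bool → Option (List ℕ × List Bool)
  | b7 :: b6 :: b5 :: b4 :: b3 :: b2 :: b1 :: b0 :: rest =>
    let k := Nat.ofDigits 2 ([b0, b1, b2, b3, b4, b5, b6, b7].map Bool.toNat)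
    if k = Ascii.newline then some ([], rest)
    else (readLine rest).map fun r => (k :: r.1, r.2)
  | _ => none

/-! ### Primitive functions without side effects -/

namespace Sexp

/-- The elements of a list; an atom has none. -/
def elems : Sexp → List Sexp
  | .list l => l
  | _ => []

/-- The numerical value; S-expressions that are not numbers count as 0. -/
def val : Sexp → ℕ
  | .num k => k
  | _ => 0

def ofBool (b : Bool) : Sexp := .word (if b then Kw.true else Kw.false)

/-- A bit string as a list of 0's and 1's. -/
def ofBits (l : List Bool) : Sexp := .list (l.map fun b => .num b.toNat)

/-- The bit string given by a list of 0's and 1's; every element other than 0 counts as 1. -/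
def bitList (s : Sexp) : List Bool := s.elems.map fun b => decide (b ≠ .num 0)

def isAtom : Sexp → Bool
  | .list (_ :: _) => false
  | _ => true

/-- The first element; an atom yields itself. -/
def car : Sexp → Sexp
  | .list (s :: _) => s
  | s => s

/-- All but the first element; an atom yields itself. -/
def cdr : Sexp → Sexp
  | .list (_ :: l) => .list l
  | s => s

/-- Put `s` in front of the list `s'`; the result is `s` if `s'` is not a list. -/
def cons (s : Sexp) : Sexp → Sexp
  | .list l => .list (s :: l)
  | _ => s

end Sexp

/-- The primitive functions without side effects, as functions of their first two
arguments. Subtraction on the unsigned integers is truncated at 0. -/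
def pureOps : List (Word × (Sexp → Sexp → Sexp)) :=
  [(Kw.car, fun s _ => s.car),
   (Kw.cdr, fun s _ => s.cdr),
   (Kw.cons, fun s s' => s.cons s'),
   (Kw.atom, fun s _ => .ofBool s.isAtom),
   (Kw.eq, fun s s' => .ofBool (decide (s = s'))),
   (Kw.append, fun s s' => .list (s.elems ++ s'.elems)),
   (Kw.length, fun s _ => .num s.elems.length),
   (Kw.size, fun s _ => .num s.text.length),
   (Kw.bits, fun s _ => .ofBits s.toBits),
   (Kw.debug, fun s _ => s),
   (Kw.add, fun s s' => .num (s.val + s'.val)),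
   (Kw.sub, fun s s' => .num (s.val - s'.val)),
   (Kw.mul, fun s s' => .num (s.val * s'.val)),
   (Kw.pow, fun s s' => .num (s.val ^ s'.val)),
   (Kw.lt, fun s s' => .ofBool (decide (s.val < s'.val))),
   (Kw.gt, fun s s' => .ofBool (decide (s.val > s'.val))),
   (Kw.le, fun s s' => .ofBool (decide (s.val ≤ s'.val))),
   (Kw.ge, fun s s' => .ofBool (decide (s.val ≥ s'.val))),
   (Kw.base2to10, fun s _ => .num (Nat.ofDigits 2 (s.bitList.reverse.map Bool.toNat))),
   (Kw.base10to2, fun s _ => .list ((Nat.digits 2 s.val).reverse.map .num))]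

/-- The pure primitive function named by an S-expression, if there is one. -/
def pureOp? (fn : Sexp) : Option (Sexp → Sexp → Sexp) :=
  (pureOps.find? fun o => decide (fn = .word o.1)).map Prod.snd

/-! ### The interpreter -/

/-- The two ways in which an evaluation is aborted. -/
inductive Err : Type
  | outOfTime : Err
  | outOfData : Err

def Err.toSexp : Err → Sexp
  | .outOfTime => .word Kw.outOfTime
  | .outOfData => .word Kw.outOfData

/-- The raw binary data not yet read, and the displays captured so far. -/
structure State : Type where
  tape : List Bool
  displays : List Sexp

/-- Computations that access the binary data and produce displays, and that end with a
value or are aborted; `none` stands for a computation that has not ended yet. -/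
abbrev Comp (α : Type) : Type := State → Option (Except Err α × State)

namespace Comp

def ret {α : Type} (x : α) : Comp α := fun st => some (.ok x, st)

def fail {α : Type} (er : Err) : Comp α := fun st => some (.error er, st)

def andThen {α β : Type} (m : Comp α) (k : α → Comp β) : Comp β := fun st =>
  match m st with
  | none => none
  | some (.error er, st') => some (.error er, st')
  | some (.ok x, st') => k x st'

end Comp

/-- Bindings of variables, the most recent one first. -/
abbrev Env : Type := List (Word × Sexp)

/-- Without a binding, `nil` has the value `()` and every other word has itself as value. -/
def lookup : Env → Word → Sexp
  | [], w => if w = Kw.nil then .list [] else .word w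
  | (w', s) :: env, w => if w' = w then s else lookup env w

/-- Bind the variables in a list to the arguments; missing arguments are `()`. -/
def bindVars : List Sexp → List Sexp → Env → Env
  | .word w :: vars, args, env => (w, args.headD (.list [])) :: bindVars vars args.tail env
  | _ :: vars, args, env => bindVars vars args.tail env
  | [], _, env => env

/-- Evaluate a list of expressions from left to right. -/
def evalArgs (ev : Sexp → Comp Sexp) : List Sexp → Comp (List Sexp)
  | [] => Comp.ret []
  | e :: es => (ev e).andThen fun s => (evalArgs ev es).andThen fun ss => Comp.ret (s :: ss)

def doReadBit : Comp Sexp := fun st =>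
  match st.tape with
  | [] => some (.error .outOfData, st)
  | b :: rest => some (.ok (.num b.toNat), { st with tape := rest })

def doReadExp : Comp Sexp := fun st =>
  match readLine st.tape with
  | none => some (.error .outOfData, st)
  | some (line, rest) => some (.ok (parseLine line), { st with tape := rest })

def doDisplay (s : Sexp) : Comp Sexp := fun st =>
  some (.ok s, { st with displays := st.displays ++ [s] })

/-- The time limit given by the first argument of `try`. -/
def timeLimit (s : Sexp) : WithTop ℕ := if s = .word Kw.noTimeLimit then ⊤ else (s.val : WithTop ℕ)

/-- The effect of `try`, where `body d` evaluates the given expression in time `d`.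
The expression has the list `data` as its binary data and its displays are captured; the
state outside is not touched. If the enclosing computation has no more time left than the
limit of this `try`, then running out of time aborts the enclosing computation as well. -/
def doTry (remaining limit : WithTop ℕ) (data : Sexp) (body : WithTop ℕ → Comp Sexp) : Comp Sexp := fun st =>
  match body (min remaining limit) { tape := data.bitList, displays := [] } with
  | none => none
  | some (.ok s, st') =>
    some (.ok (.list [.word Kw.success, s, .list st'.displays]), st)
  | some (.error .outOfTime, st') =>
    if remaining ≤ limit then some (.error .outOfTime, st)
    else some (.ok (.list [.word Kw.failure, Err.toSexp .outOfTime, .list st'.displays]), st)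
  | some (.error .outOfData, st') =>
    some (.ok (.list [.word Kw.failure, Err.toSexp .outOfData, .list st'.displays]), st)

/-- Apply the function `fn` to the argument values `args`. Here `ev d env e` evaluates `e`
in time `d`. Time is measured by the depth of nested calls of `eval`, `try` and defined
functions. A function that is not primitive is `(lambda (variables...) body)`; its free
variables get the values that they have at the point of call. Missing arguments are `()`,
superfluous ones are ignored. -/
def applyFn (ev : WithTop ℕ → Env → Sexp → Comp Sexp) (d : WithTop ℕ) (env : Env) (fn : Sexp)
    (args : List Sexp) : Comp Sexp :=
  let arg (j : ℕ) : Sexp := args.getD j (.list [])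
  match pureOp? fn with
  | some op => Comp.ret (op (arg 0) (arg 1))
  | none =>
    if fn = .word Kw.display then doDisplay (arg 0)
    else if fn = .word Kw.readBit then doReadBit
    else if fn = .word Kw.readExp then doReadExp
    else if d = 0 then Comp.fail .outOfTime
    else if fn = .word Kw.eval then ev (d - 1) [] (arg 0)
    else if fn = .word Kw.attempt then
      doTry (d - 1) (timeLimit (arg 0)) (arg 2) fun d' => ev d' [] (arg 1)
    else ev (d - 1) (bindVars fn.cdr.car.elems args env) fn.cdr.cdr.car

/-- The interpreter. The expression `e` is evaluated in the environment `env` with time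
limit `d`. The first argument bounds the recursion depth of the interpreter itself; the
result is `none` exactly if this bound is too small. -/
def evalN : ℕ → WithTop ℕ → Env → Sexp → Comp Sexp
  | 0, _, _, _ => fun _ => none
  | _ + 1, _, env, .word w => Comp.ret (lookup env w)
  | _ + 1, _, _, .num k => Comp.ret (.num k)
  | _ + 1, _, _, .list [] => Comp.ret (.list [])
  | n + 1, d, env, .list (e :: es) =>
    (evalN n d env e).andThen fun fn =>
      if fn = .word Kw.quote then Comp.ret (es.headD (.list []))
      else if fn = .word Kw.cond then
        (evalN n d env (es.headD (.list []))).andThen fun s =>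
          evalN n d env (es.getD (if s = .word Kw.false then 2 else 1) (.list []))
      else
        (evalArgs (evalN n d env) es).andThen fun args =>
          applyFn (evalN n) d env fn args

/-- The outcome of the evaluation of `e`, without time limit and in the environment
without bindings, with `p` as binary data; undefined if the evaluation does not end. -/
def outcome (e : Sexp) (p : List Bool) : Part (Except Err Sexp × State) :=
  Nat.rfindOpt fun n => evalN n ⊤ [] e { tape := p, displays := [] }

/-! ### The universal computer and program-size complexity -/

/-- The expression `(eval (read-exp))`. -/
def evalReadExp : Sexp := .list [.word Kw.eval, .list [.word Kw.readExp]]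

/-- The self-delimiting universal computer: `(eval (read-exp))` is tried on the binary
data `p` without time limit. `U p` is defined, and is the value obtained, if the evaluation
ends without running out of data and has read `p` up to its end. Thus no extension of a
program on which `U` is defined is another such program. -/
def U : List Bool →. Sexp := fun p =>
  (outcome evalReadExp p).bind fun r =>
    match r with
    | (.ok s, { tape := [], displays := _ }) => Part.some s
    | _ => Part.none

/-- The universal computer as a LISP function: the value of
`(car (cdr (try no-time-limit (' (eval (read-exp))) (' p))))`, where `p` is given as a list
of 0's and 1's. -/
def lispU : List Bool →. Sexp := fun p =>
  (outcome
      (.list [.word Kw.car, .list [.word Kw.cdr,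
        .list [.word Kw.attempt, .word Kw.noTimeLimit,
          .list [.word Kw.quote, evalReadExp],
          .list [.word Kw.quote, Sexp.ofBits p]]]]) []).bind fun r =>
    match r with
    | (.ok s, _) => Part.some s
    | _ => Part.none

/-- The size in bits of the smallest program for `s`; it is `⊤` if there is none. -/
noncomputable def H (s : Sexp) : ℕ∞ := ⨅ (p : List Bool) (_ : s ∈ U p), (p.length : ℕ∞)

/-- The pair of two S-expressions, as a list with two elements. -/
def pair (s s' : Sexp) : Sexp := .list [s, s']

/-- The joint complexity: the size of the smallest program for the pair. -/
noncomputable def jointH (s s' : Sexp) : ℕ∞ := H (pair s s')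

/-- `p` is an elegant program for `s`: it computes `s` and is as small as possible. -/
def IsElegant (p : List Bool) (s : Sexp) : Prop := s ∈ U p ∧ (p.length : ℕ∞) = H s

/-- The expression `cons eval read-exp cons eval read-exp nil` with its parentheses supplied:
`(cons (eval (read-exp)) (cons (eval (read-exp)) nil))`. -/
def pairingExp : Sexp :=
  .list [.word Kw.cons, evalReadExp, .list [.word Kw.cons, evalReadExp, .word Kw.nil]]

/-- The prefix for the universal computer that is given by `pairingExp`. -/
def pairingPrefix : List Bool := pairingExp.toBits

end ChaitinLisp

namespace ChaitinLisp

-- On the tape `pairingPrefix ++ p ++ q` the computer reads its first line, which is the text of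
-- `pairingExp`, and evaluates that expression on `p ++ q`. Each of its two copies of `(eval
-- (read-exp))` is the universal computer again, in the initial environment and without time limit.
-- Programs delimit themselves: a run that succeeds on `p` and reads exactly `p` never looks past
-- its end, so with `q` appended it does the same and leaves `q` for the second copy. The two values
-- are then consed into a list.
--
-- The substance is this locality (`isLocal_evalN`), proved by induction along the interpreter.
-- Monotonicity in the recursion bound (`evalN_mono`) allows sub-evaluations with different bounds
-- to be combined, so that the rest can be argued with the big-step relation `Evaluates`. The facts
-- about the concrete prefix are computations. The inequality follows by taking infima over all
-- programs for both components.

/-! ### More recursion depth does not change a result -/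

/-- Every result of `m` is a result of `m'`. -/
def Comp.Le {α : Type} (m m' : Comp α) : Prop := ∀ st r, m st = some r → m' st = some r

theorem Comp.Le.refl {α : Type} (m : Comp α) : m.Le m := fun _ _ h => h

theorem Comp.Le.andThen {α β : Type} {m m' : Comp α} {k k' : α → Comp β} (hm : m.Le m')
    (hk : ∀ x, (k x).Le (k' x)) : (m.andThen k).Le (m'.andThen k') := by
  intro st r h
  unfold Comp.andThen at h ⊢
  rcases hst : m st with _ | ⟨er | x, st'⟩
  · simp [hst] at h
  · simpa [hst, hm _ _ hst] using h
  · simp only [hst] at h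
    simpa [hm _ _ hst] using hk x _ _ h

theorem evalArgs_le {ev ev' : Sexp → Comp Sexp} (h : ∀ e, (ev e).Le (ev' e)) :
    ∀ es, (evalArgs ev es).Le (evalArgs ev' es)
  | [] => .refl _
  | e :: es => (h e).andThen fun _ => (evalArgs_le h es).andThen fun _ => .refl _

/-- A bound that is too small gives `none`, which `try` passes on. Only genuine aborts are turned
into failure values, so `try` cannot make the recursion bound observable. -/
theorem doTry_le {body body' : WithTop ℕ → Comp Sexp} (h : ∀ d, (body d).Le (body' d))
    (remaining limit : WithTop ℕ) (data : Sexp) :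
    (doTry remaining limit data body).Le (doTry remaining limit data body') := by
  intro st r hr
  unfold doTry at hr ⊢
  rcases hb : body (min remaining limit) ⟨data.bitList, []⟩ with _ | r'
  · simp [hb] at hr
  · rw [h _ _ _ hb]
    rwa [hb] at hr

theorem applyFn_le {ev ev' : WithTop ℕ → Env → Sexp → Comp Sexp}
    (h : ∀ d env e, (ev d env e).Le (ev' d env e)) (d : WithTop ℕ) (env : Env) (fn : Sexp)
    (args : List Sexp) : (applyFn ev d env fn args).Le (applyFn ev' d env fn args) := by
  unfold applyFn
  dsimp only
  split
  · exact .refl _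
  · split_ifs
    any_goals exact .refl _
    · exact h _ _ _
    · exact doTry_le (fun _ => h _ _ _) _ _ _
    · exact h _ _ _

theorem evalN_le_succ (n : ℕ) : ∀ d env e, (evalN n d env e).Le (evalN (n + 1) d env e) := by
  induction n with
  | zero => intro d env e st r h; simp [evalN] at h
  | succ n ih =>
    intro d env e
    match e with
    | .word w => exact fun _ _ h => h
    | .num k => exact fun _ _ h => h
    | .list [] => exact fun _ _ h => h
    | .list (e :: es) =>
      rw [evalN, evalN]
      refine (ih _ _ _).andThen fun fn => ?_
      split_ifs
      · exact .refl _
      · exact (ih _ _ _).andThen fun _ => ih _ _ _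
      · exact (evalArgs_le (ih d env) es).andThen fun _ => applyFn_le ih _ _ _ _

theorem evalN_mono {n n' : ℕ} (hn : n ≤ n') (d : WithTop ℕ) (env : Env) (e : Sexp) :
    (evalN n d env e).Le (evalN n' d env e) := by
  induction hn with
  | refl => exact .refl _
  | step _ ih => exact fun st r h => evalN_le_succ _ _ _ _ _ _ (ih st r h)

/-! ### Unread data and earlier displays do not influence a successful evaluation -/

/-- A successful run of `m` stays the same if data is added at the end of the tape and
displays are added in front. -/
def Comp.IsLocal {α : Type} (m : Comp α) : Prop :=
  ∀ t ds x t' ds', m ⟨t, ds⟩ = some (.ok x, ⟨t', ds'⟩) →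
    ∀ u es, m ⟨t ++ u, es ++ ds⟩ = some (.ok x, ⟨t' ++ u, es ++ ds'⟩)

namespace Comp.IsLocal

theorem ret {α : Type} (x : α) : (Comp.ret x).IsLocal := by
  intro t ds y t' ds' h u es
  simp only [Comp.ret, Option.some.injEq, Prod.mk.injEq, Except.ok.injEq, State.mk.injEq] at h ⊢
  obtain ⟨rfl, rfl, rfl⟩ := h
  simp

theorem fail {α : Type} (er : Err) : (Comp.fail er : Comp α).IsLocal := by
  intro t ds y t' ds' h
  simp [Comp.fail] at h

theorem andThen {α β : Type} {m : Comp α} {k : α → Comp β} (hm : m.IsLocal)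
    (hk : ∀ x, (k x).IsLocal) : (m.andThen k).IsLocal := by
  intro t ds y t' ds' h u es
  unfold Comp.andThen at h ⊢
  rcases hst : m ⟨t, ds⟩ with _ | ⟨er | x, ⟨t₁, ds₁⟩⟩
  · simp [hst] at h
  · simp [hst] at h
  · simp only [hst] at h
    simpa only [hm _ _ _ _ _ hst u es] using hk x _ _ _ _ _ h u es

end Comp.IsLocal

theorem isLocal_evalArgs {ev : Sexp → Comp Sexp} (h : ∀ e, (ev e).IsLocal) :
    ∀ es, (evalArgs ev es).IsLocal
  | [] => .ret _
  | e :: es => (h e).andThen fun _ => (isLocal_evalArgs h es).andThen fun _ => .ret _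

/-- Reading stops at the first newline, and whatever follows is handed back untouched. -/
theorem readLine_append {t : List Bool} {line : List ℕ} {rest : List Bool}
    (h : readLine t = some (line, rest)) (u : List Bool) :
    readLine (t ++ u) = some (line, rest ++ u) := by
  fun_induction readLine t generalizing line rest with
  | case1 b7 b6 b5 b4 b3 b2 b1 b0 t k =>
    rename_i hk
    simp only [Option.some.injEq, Prod.mk.injEq] at h
    obtain ⟨rfl, rfl⟩ := h
    simp only [List.cons_append]
    rw [readLine]
    simp only [k, hk, if_true]
  | case2 b7 b6 b5 b4 b3 b2 b1 b0 t k =>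
    rename_i hk ih
    obtain ⟨⟨l, r⟩, hlr, h⟩ := Option.map_eq_some_iff.1 h
    simp only [Prod.mk.injEq] at h
    obtain ⟨rfl, rfl⟩ := h
    simp only [List.cons_append]
    rw [readLine, ih hlr]
    simp only [k, hk, if_false, Option.map_some]
  | case3 => simp at h

theorem isLocal_doDisplay (s : Sexp) : (doDisplay s).IsLocal := by
  intro t ds x t' ds' h u es
  simp only [doDisplay, Option.some.injEq, Prod.mk.injEq, Except.ok.injEq, State.mk.injEq] at h ⊢
  obtain ⟨rfl, rfl, rfl⟩ := h
  simp

/-- Locality speaks of successful runs only: on an empty tape this aborts, and appended data would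
change that. -/
theorem isLocal_doReadBit : doReadBit.IsLocal := by
  intro t ds x t' ds' h u es
  cases t with
  | nil => simp [doReadBit] at h
  | cons b t =>
    simp only [doReadBit, List.cons_append, Option.some.injEq, Prod.mk.injEq, Except.ok.injEq,
      State.mk.injEq] at h ⊢
    obtain ⟨rfl, rfl, rfl⟩ := h
    simp

theorem isLocal_doReadExp : doReadExp.IsLocal := by
  intro t ds x t' ds' h u es
  unfold doReadExp at h ⊢
  dsimp only at h ⊢
  rcases hl : readLine t with _ | ⟨line, rest⟩
  · simp [hl] at h
  · rw [readLine_append hl]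
    simp only [hl, Option.some.injEq, Prod.mk.injEq, Except.ok.injEq, State.mk.injEq] at h ⊢
    obtain ⟨rfl, rfl, rfl⟩ := h
    simp

/-- Nothing is needed of `body`: it runs on its own data with an empty list of displays, so its
outcome does not depend on the outer state, which is returned as it was. -/
theorem isLocal_doTry (remaining limit : WithTop ℕ) (data : Sexp)
    (body : WithTop ℕ → Comp Sexp) : (doTry remaining limit data body).IsLocal := by
  intro t ds x t' ds' h u es
  unfold doTry at h ⊢
  generalize body (min remaining limit) ⟨data.bitList, []⟩ = r at h ⊢
  rcases r with _ | ⟨(_ | _) | s, st'⟩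
  · simp at h
  · dsimp only at h ⊢
    split_ifs at h ⊢
    · simp at h
    · simp only [Option.some.injEq, Prod.mk.injEq, Except.ok.injEq, State.mk.injEq] at h ⊢
      obtain ⟨rfl, rfl, rfl⟩ := h
      simp
  all_goals
    simp only [Option.some.injEq, Prod.mk.injEq, Except.ok.injEq, State.mk.injEq] at h ⊢
    obtain ⟨rfl, rfl, rfl⟩ := h
    simp

theorem isLocal_applyFn {ev : WithTop ℕ → Env → Sexp → Comp Sexp}
    (h : ∀ d env e, (ev d env e).IsLocal) (d : WithTop ℕ) (env : Env) (fn : Sexp)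
    (args : List Sexp) : (applyFn ev d env fn args).IsLocal := by
  unfold applyFn
  dsimp only
  split
  · exact .ret _
  · split_ifs
    · exact isLocal_doDisplay _
    · exact isLocal_doReadBit
    · exact isLocal_doReadExp
    · exact .fail _
    · exact h _ _ _
    · exact isLocal_doTry _ _ _ _
    · exact h _ _ _

theorem isLocal_evalN (n : ℕ) : ∀ d env e, (evalN n d env e).IsLocal := by
  induction n with
  | zero => intro d env e t ds x t' ds' h; simp [evalN] at h
  | succ n ih =>
    intro d env e
    match e with
    | .word w => exact .ret _
    | .num k => exact .ret _
    | .list [] => exact .ret _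
    | .list (e :: es) =>
      rw [evalN]
      refine (ih _ _ _).andThen fun fn => ?_
      split_ifs
      · exact .ret _
      · exact (ih _ _ _).andThen fun _ => ih _ _ _
      · exact (isLocal_evalArgs (ih d env) es).andThen fun _ => isLocal_applyFn ih _ _ _ _

/-! ### Evaluation of calls -/

/-- The evaluation of `e` without time limit and without bindings leads from the state `st`
to the value `s` and the state `st'`. -/
def Evaluates (e : Sexp) (st : State) (s : Sexp) (st' : State) : Prop :=
  ∃ n, evalN n ⊤ [] e st = some (.ok s, st')

theorem Evaluates.extend {e s : Sexp} {t t' : List Bool} {ds ds' : List Sexp}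
    (h : Evaluates e ⟨t, ds⟩ s ⟨t', ds'⟩) (u : List Bool) (es : List Sexp) :
    Evaluates e ⟨t ++ u, es ++ ds⟩ s ⟨t' ++ u, es ++ ds'⟩ :=
  h.imp fun n hn => isLocal_evalN n _ _ _ _ _ _ _ _ hn u es

/-- The search returns the result at the first sufficient bound; by monotonicity every sufficient
bound gives the same result. -/
theorem mem_outcome {e : Sexp} {p : List Bool} {r : Except Err Sexp × State} :
    r ∈ outcome e p ↔ ∃ n, evalN n ⊤ [] e ⟨p, []⟩ = some r :=
  Nat.rfindOpt_mono fun hmn h => evalN_mono hmn _ _ _ _ _ h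

theorem mem_U {s : Sexp} {p : List Bool} :
    s ∈ U p ↔ ∃ ds, Evaluates evalReadExp ⟨p, []⟩ s ⟨[], ds⟩ := by
  unfold U
  rw [Part.mem_bind_iff]
  constructor
  · rintro ⟨⟨er | s', ⟨_ | ⟨b, t⟩, ds⟩⟩, hr, hs⟩
    · simp at hs
    · simp at hs
    · obtain rfl : s = s' := by simpa using hs
      exact ⟨ds, mem_outcome.1 hr⟩
    · simp at hs
  · rintro ⟨ds, h⟩
    exact ⟨_, mem_outcome.2 h, Part.mem_some _⟩

theorem Evaluates.word {w : Word} (hw : w ≠ Kw.nil) (st : State) :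
    Evaluates (.word w) st (.word w) st :=
  ⟨1, by simp [evalN, Comp.ret, lookup, hw]⟩

theorem Evaluates.nil (st : State) : Evaluates (.word Kw.nil) st (.list []) st :=
  ⟨1, by simp [evalN, Comp.ret, lookup]⟩

theorem Evaluates.quote (s : Sexp) (st : State) :
    Evaluates (.list [.word Kw.quote, s]) st s st :=
  ⟨2, by
    have : Kw.quote ≠ Kw.nil := by decide
    simp [evalN, Comp.ret, Comp.andThen, lookup, this]⟩

/-- The arguments `es` have the values `ss`. -/
inductive EvaluatesArgs : List Sexp → State → List Sexp → State → Prop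
  | nil (st : State) : EvaluatesArgs [] st [] st
  | cons {e s : Sexp} {es ss : List Sexp} {st st' st'' : State} (h : Evaluates e st s st')
      (hs : EvaluatesArgs es st' ss st'') : EvaluatesArgs (e :: es) st (s :: ss) st''

theorem EvaluatesArgs.exists_evalArgs {es ss : List Sexp} {st st' : State}
    (h : EvaluatesArgs es st ss st') :
    ∃ n, evalArgs (evalN n ⊤ []) es st = some (.ok ss, st') := by
  induction h with
  | nil st => exact ⟨0, rfl⟩
  | cons h _ ih =>
    obtain ⟨n, hn⟩ := h
    obtain ⟨m, hm⟩ := ih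
    -- Head and tail come with separate bounds; monotonicity lifts both to the maximum.
    refine ⟨max n m, ?_⟩
    have hn' := evalN_mono (le_max_left n m) _ _ _ _ _ hn
    have hm' := evalArgs_le (evalN_mono (le_max_right n m) _ _) _ _ _ hm
    simp [evalArgs, Comp.andThen, Comp.ret, hn', hm']

/-- A call of the function named by the word `w`, other than `'` and `if`. -/
theorem Evaluates.call {w : Word} (hnil : w ≠ Kw.nil) (hquote : w ≠ Kw.quote)
    (hcond : w ≠ Kw.cond) {es ss : List Sexp} {st st' st'' : State} {s : Sexp}
    (hes : EvaluatesArgs es st ss st')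
    (happly : ∃ n, applyFn (evalN n) ⊤ [] (.word w) ss st' = some (.ok s, st'')) :
    Evaluates (.list (.word w :: es)) st s st'' := by
  obtain ⟨n, hn⟩ := hes.exists_evalArgs
  obtain ⟨m, hm⟩ := happly
  -- One level for the call itself, and one because evaluating the word `w` needs a positive bound
  -- even if `n = m = 0`.
  refine ⟨max n m + 1 + 1, ?_⟩
  have hn' := evalArgs_le (evalN_mono ((le_max_left n m).trans (Nat.le_add_right _ 1)) _ _) _ _ _ hn
  have hm' := applyFn_le (evalN_mono ((le_max_right n m).trans (Nat.le_add_right _ 1))) _ _ _ _ _ _ hm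
  rw [evalN]
  simp only [Comp.andThen]
  rw [show evalN (max n m + 1) ⊤ [] (.word w) st = some (.ok (.word w), st) by
    simp [evalN, Comp.ret, lookup, hnil]]
  simp only [Sexp.word.injEq, hquote, hcond, if_false]
  simpa only [Comp.andThen, hn'] using hm'

theorem Evaluates.pureCall {w : Word} (hnil : w ≠ Kw.nil) (hquote : w ≠ Kw.quote)
    (hcond : w ≠ Kw.cond) {op : Sexp → Sexp → Sexp} (hop : pureOp? (.word w) = some op)
    {es ss : List Sexp} {st st' : State} (hes : EvaluatesArgs es st ss st') :
    Evaluates (.list (.word w :: es)) st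
      (op (ss.getD 0 (.list [])) (ss.getD 1 (.list []))) st' :=
  .call hnil hquote hcond hes ⟨0, by simp [applyFn, hop, Comp.ret]⟩

theorem pureOp?_car : pureOp? (.word Kw.car) = some fun s _ => s.car := by
  simp [pureOp?, pureOps]

theorem pureOp?_cdr : pureOp? (.word Kw.cdr) = some fun s _ => s.cdr := by
  have : Kw.cdr ≠ Kw.car := by decide
  simp [pureOp?, pureOps, this]

theorem pureOp?_cons : pureOp? (.word Kw.cons) = some fun s s' => s.cons s' := by
  have h : Kw.cons ≠ Kw.car := by decide
  have h' : Kw.cons ≠ Kw.cdr := by decide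
  simp [pureOp?, pureOps, h, h']

theorem pureOp?_eq_none {w : Word} (h : w ∉ pureOps.map Prod.fst) :
    pureOp? (.word w) = none := by
  rw [pureOp?, Option.map_eq_none_iff, List.find?_eq_none]
  intro o ho
  simp only [Sexp.word.injEq, decide_eq_true_eq]
  rintro rfl
  exact h (List.mem_map_of_mem ho)

theorem pureOp?_eval : pureOp? (.word Kw.eval) = none := pureOp?_eq_none (by decide)

theorem pureOp?_readExp : pureOp? (.word Kw.readExp) = none := pureOp?_eq_none (by decide)

theorem pureOp?_attempt : pureOp? (.word Kw.attempt) = none := pureOp?_eq_none (by decide)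

theorem Evaluates.readExp {t rest : List Bool} {line : List ℕ} (ds : List Sexp)
    (h : readLine t = some (line, rest)) :
    Evaluates (.list [.word Kw.readExp]) ⟨t, ds⟩ (parseLine line) ⟨rest, ds⟩ := by
  refine .call (by decide) (by decide) (by decide) (.nil _) ⟨0, ?_⟩
  have h₁ : Kw.readExp ≠ Kw.display := by decide
  have h₂ : Kw.readExp ≠ Kw.readBit := by decide
  simp [applyFn, pureOp?_readExp, h₁, h₂, doReadExp, h]

theorem Evaluates.eval {e e' s : Sexp} {st st' st'' : State} (h : Evaluates e st e' st')
    (h' : Evaluates e' st' s st'') : Evaluates (.list [.word Kw.eval, e]) st s st'' := by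
  refine .call (by decide) (by decide) (by decide) (.cons h (.nil _)) (h'.imp fun n hn => ?_)
  have h₁ : Kw.eval ≠ Kw.display := by decide
  have h₂ : Kw.eval ≠ Kw.readBit := by decide
  have h₃ : Kw.eval ≠ Kw.readExp := by decide
  -- `eval` lowers the time limit by one; an unlimited evaluation thus stays unlimited, as
  -- `Evaluates` requires.
  have h₄ : (⊤ - 1 : WithTop ℕ) = ⊤ := rfl
  simp [applyFn, pureOp?_eval, h₁, h₂, h₃, h₄, hn]

theorem bitList_ofBits (p : List Bool) : (Sexp.ofBits p).bitList = p := by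
  simp only [Sexp.ofBits, Sexp.bitList, Sexp.elems, List.map_map]
  conv_rhs => rw [← List.map_id p]
  refine List.map_congr_left fun b _ => ?_
  cases b <;> simp

theorem Evaluates.attempt {e₁ e₂ e s : Sexp} {p : List Bool} {st st₁ st₂ st' : State}
    (h₁ : Evaluates e₁ st e st₁) (h₂ : Evaluates e₂ st₁ (Sexp.ofBits p) st₂)
    (h : Evaluates e ⟨p, []⟩ s st') :
    Evaluates (.list [.word Kw.attempt, .word Kw.noTimeLimit, e₁, e₂]) st
      (.list [.word Kw.success, s, .list st'.displays]) st₂ := by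
  refine .call (by decide) (by decide) (by decide)
    (.cons (.word (by decide) _) (.cons h₁ (.cons h₂ (.nil _)))) (h.imp fun n hn => ?_)
  have n₁ : Kw.attempt ≠ Kw.display := by decide
  have n₂ : Kw.attempt ≠ Kw.readBit := by decide
  have n₃ : Kw.attempt ≠ Kw.readExp := by decide
  have n₄ : Kw.attempt ≠ Kw.eval := by decide
  have n₅ : (⊤ - 1 : WithTop ℕ) = ⊤ := rfl
  simp [applyFn, pureOp?_attempt, n₁, n₂, n₃, n₄, n₅, doTry, timeLimit, bitList_ofBits, hn]

/-! ### The universal computer as a LISP function -/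

/-- The `try` supplies `p` as inner data and yields `(success s displays)`, from which `cdr` and
`car` extract `s`. The outer tape stays empty. -/
theorem mem_lispU {s : Sexp} {p : List Bool} (h : s ∈ U p) : s ∈ lispU p := by
  obtain ⟨ds, h⟩ := mem_U.1 h
  unfold lispU
  rw [Part.mem_bind_iff]
  refine ⟨(.ok s, ⟨[], []⟩), mem_outcome.2 ?_, Part.mem_some _⟩
  exact Evaluates.pureCall (by decide) (by decide) (by decide) pureOp?_car <|
    .cons (.pureCall (by decide) (by decide) (by decide) pureOp?_cdr <|
      .cons (.attempt (.quote _ _) (.quote _ _) h) (.nil _)) (.nil _)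

/-! ### The pairing prefix -/

/-- The text has 53 characters; with the newline this makes 54 characters of eight bits. -/
theorem length_pairingPrefix : pairingPrefix.length = 432 := by
  decide +kernel

theorem readLine_pairingPrefix : readLine pairingPrefix = some (pairingExp.text, []) := by
  decide +kernel

/-- Parsing inverts printing; this is needed for this one expression only, so it is checked by
computation. -/
theorem parseLine_pairingExp : parseLine pairingExp.text = pairingExp := by
  decide +kernel

theorem Evaluates.pairingExp {x y : Sexp} {p q : List Bool} {ds ds' : List Sexp}
    (hx : Evaluates evalReadExp ⟨p, []⟩ x ⟨[], ds⟩)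
    (hy : Evaluates evalReadExp ⟨q, []⟩ y ⟨[], ds'⟩) :
    Evaluates pairingExp ⟨p ++ q, []⟩ (pair x y) ⟨[], ds ++ ds'⟩ := by
  -- The first run needs `q` behind its data; the second runs to the end of the tape but starts with
  -- the displays `ds` already recorded.
  have hx' := hx.extend q []
  have hy' := hy.extend [] ds
  simp only [List.nil_append, List.append_nil] at hx' hy'
  exact .pureCall (by decide) (by decide) (by decide) pureOp?_cons <|
    .cons hx' <| .cons (.pureCall (by decide) (by decide) (by decide) pureOp?_cons <|
      .cons hy' <| .cons (.nil _) (.nil _)) (.nil _)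

theorem pair_mem_U {x y : Sexp} {p q : List Bool} (hx : x ∈ U p) (hy : y ∈ U q) :
    pair x y ∈ U (pairingPrefix ++ p ++ q) := by
  obtain ⟨ds, hx⟩ := mem_U.1 hx
  obtain ⟨ds', hy⟩ := mem_U.1 hy
  refine mem_U.2 ⟨ds ++ ds', ?_⟩
  rw [List.append_assoc]
  -- `read-exp` consumes exactly the prefix, so the parsed expression is evaluated on `p ++ q`.
  refine .eval (.readExp [] (readLine_append readLine_pairingPrefix (p ++ q))) ?_
  rw [parseLine_pairingExp]
  exact hx.pairingExp hy

/-! ### Subadditivity of program-size complexity -/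

theorem H_le {s : Sexp} {p : List Bool} (h : s ∈ U p) : H s ≤ p.length := iInf₂_le p h

theorem jointH_le (x y : Sexp) : jointH x y ≤ H x + H y + 432 := by
  have key : ∀ p, x ∈ U p → ∀ q, y ∈ U q →
      jointH x y ≤ (p.length : ℕ∞) + (q.length : ℕ∞) + 432 := by
    intro p hp q hq
    refine (H_le (pair_mem_U hp hq)).trans_eq ?_
    simp only [List.length_append, length_pairingPrefix]
    push_cast
    ring
  unfold H
  -- Moving the infima out of the sum avoids choosing minimal programs and covers the case of no
  -- program, where the infimum is `⊤`.
  simp only [ENat.iInf_add, ENat.add_iInf]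
  exact le_iInf₂ fun q hq => le_iInf₂ fun p hp => key p hp q hq

end ChaitinLisp

open ChaitinLisp in
theorem mainTheorem5 :
    pairingPrefix.length = 432 ∧
    (∀ (x y : Sexp) (xStar yStar : List Bool), IsElegant xStar x → IsElegant yStar y →
      U (pairingPrefix ++ xStar ++ yStar) = Part.some (pair x y) ∧
      lispU (pairingPrefix ++ xStar ++ yStar) = Part.some (pair x y)) ∧
    (∀ x y : Sexp, jointH x y ≤ H x + H y + 432) := by
  refine ⟨length_pairingPrefix, fun x y p q hp hq => ?_, jointH_le⟩
  have h := pair_mem_U hp.1 hq.1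
  exact ⟨Part.eq_some_iff.2 h, Part.eq_some_iff.2 (mem_lispU h)⟩
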